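/- A conic in the Euclidean plane is the locus of a quadratic equation with nonzero quadratic part; its tangents are taken at nonsingular points, and it may be degenerate unless the contrary is said. Two curves are tangent at a point if they have a common tangent line there. Five points determine the conic $(VWXYZ)$ if the equation of a conic through them is unique up to a factor. Let $ABC$ be a triangle with circumcircle $\Omega$. Let $\mathcal C$ be a conic through $A,B,C$ that is tangent to a circle $\gamma$ at two distinct points $P$ and $Q$. Suppose that $P$ lies on none of the lines $AB,BC,CA$, that $P$ has an isogonal conjugate $P'\neq P$ with respect to $ABC$, that $P'$ lies on the line $PQ$, and that the conic $(ABCPP')$ is determined by these five points and is nondegenerate. Let $P_0\in\Omega$ be such that the line $P'P_0$ is tangent to $(ABCPP')$ at $P'$. Then there is an intersection point $X$ of $\gamma$ and $\Omega$ such that the conic $(ABCPX)$ is determined by its five points and the line $P_0X$ meets $\gamma$ again, at a point other than $X$, that lies on $(ABCPX)$. In two limiting positions this is understood as follows: if $P_0\ne X$ and $P_0X$ is tangent to $\gamma$ at $X$ (so that the second intersection is $X$ itself), then $P_0X$ is also tangent to $(ABCPX)$ at $X$; if $P_0=X$, then the line $P_0X$ is the tangent to $\Omega$ at $X$. Moreover,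 there is exactly one point $R\neq P$ on the line $PP'$ (namely $R=Q$) for which some conic through $A,B,C$ and some circle are tangent to each other at both $P$ and $R$. -/

import Mathlib

open EuclideanGeometry

/-- The Euclidean plane. -/
abbrev Plane : Type := EuclideanSpace ℝ (Fin 2)

/-- A (possibly degenerate) conic of the plane, given by an equation
`a x² + b x y + c y² + d x + e y + f = 0` whose quadratic part is not zero. -/
structure Conic where
  a : ℝ
  b : ℝ
  c : ℝ
  d : ℝ
  e : ℝ
  f : ℝ
  quad_ne : a ≠ 0 ∨ b ≠ 0 ∨ c ≠ 0

namespace Conic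

/-- The left-hand side of the equation of the conic. -/
def eval (K : Conic) (Z : Plane) : ℝ :=
  K.a * Z 0 ^ 2 + K.b * Z 0 * Z 1 + K.c * Z 1 ^ 2 + K.d * Z 0 + K.e * Z 1 + K.f

/-- The derivative of the equation of the conic at `T` in the direction `v`. -/
def dirDeriv (K : Conic) (T v : Plane) : ℝ :=
  (2 * K.a * T 0 + K.b * T 1 + K.d) * v 0 + (K.b * T 0 + 2 * K.c * T 1 + K.e) * v 1

/-- The points of the conic. -/
instance : Membership Plane Conic where
  mem K Z := K.eval Z = 0

/-- The conic is not degenerate: the symmetric matrix of its homogenized equation is invertible. -/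
def IsNondegenerate (K : Conic) : Prop :=
  !![K.a, K.b / 2, K.d / 2; K.b / 2, K.c, K.e / 2; K.d / 2, K.e / 2, K.f].det ≠ 0

/-- The line `ℓ` is tangent to the conic at `T`: the point `T` is a nonsingular point of the conic,
and the derivative of the equation at `T` vanishes along `ℓ`. -/
def IsTangentAt (K : Conic) (T : Plane) (ℓ : AffineSubspace ℝ Plane) : Prop :=
  T ∈ K ∧ (∃ v, K.dirDeriv T v ≠ 0) ∧ T ∈ ℓ ∧ ∀ Z ∈ ℓ, K.dirDeriv T (Z - T) = 0

/-- The conic and the circle `γ` are tangent at `T`: they have a common tangent line at `T`. -/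
def IsTangentToCircleAt (K : Conic) (γ : Sphere Plane) (T : Plane) : Prop :=
  ∃ U, U ≠ T ∧ K.IsTangentAt T line[ℝ, T, U] ∧ γ.IsTangentAt T line[ℝ, T, U]

/-- `K` is the conic through the points of `S`: it contains `S`, and the equation of every conic
that contains `S` is a multiple of the equation of `K`. -/
def IsTheConicThrough (K : Conic) (S : Set Plane) : Prop :=
  (∀ Z ∈ S, Z ∈ K) ∧
    ∀ K' : Conic, (∀ Z ∈ S, Z ∈ K') → ∃ r : ℝ, ∀ Z, K'.eval Z = r * K.eval Z

end Conic

/-- The signed area of the parallelogram spanned by `u` and `v`,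
equal to `‖u‖ ‖v‖ sin θ` for the oriented angle `θ` from `u` to `v`. -/
def cross (u v : Plane) : ℝ := u 0 * v 1 - u 1 * v 0

/-- For nonzero vectors: the directed angle modulo `π` from the line spanned by `u` to the line
spanned by `v` equals the one from `u'` to `v'` (the two angles have the same tangent,
possibly infinite; recall that the inner product is `‖u‖ ‖v‖ cos θ`). -/
def SameDirectedAngle (u v u' v' : Plane) : Prop :=
  cross u v * inner ℝ u' v' = inner ℝ u v * cross u' v'

/-- The lines `AP` and `AP'` are isogonal in the angle `BAC`: `∡(AB, AP) = ∡(AP', AC)`. -/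
def IsogonalAt (A B C P P' : Plane) : Prop :=
  SameDirectedAngle (B - A) (P - A) (P' - A) (C - A)

/-- `P'` is the isogonal conjugate of `P` in the triangle `ABC`, where `P` lies on no side line. -/
structure IsIsogonalConjugate (A B C P P' : Plane) : Prop where
  notMem_AB : P ∉ line[ℝ, A, B]
  notMem_BC : P ∉ line[ℝ, B, C]
  notMem_CA : P ∉ line[ℝ, C, A]
  atA : IsogonalAt A B C P P'
  atB : IsogonalAt B C A P P'
  atC : IsogonalAt C A B P P'

/-! Take the circumradius as unit, P as origin and PP' as real axis, so that Ω is |z + p| = 1 and P'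
= h. Let e be the product of the vertices, read as unit complex numbers about the circumcentre.
Isogonal conjugacy makes F(z) = z² − hz + m|z|² + n z̄, with m = e·conj(p + h) and n = e(p·conj(p +
h) − 1), vanish at A, B, C (`isogonal_relations`, `pencil_vanishes`). It also vanishes at P, and
since P is not on Ω, every conic through A, B, C, P has the form Re(ωF) = 0 (`mem_pencil`).

Each conic involved is then explicit. Tangency to a circle at P and at another point of the real
axis kills the xy term (`bitangent_coefficients`); so 𝒞 is Re F = 0 and γ is Re F + 2y² = 0, which
also makes Q unique. The conic ℋ is Im(ē F) = 0. Put w = p + e and let X = lw be the second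
intersection of Ω with the line from P to the point −e of Ω. There F(X) = 2i l² w₂ w
(`pencil_value_identities`), so X lies on γ, and 𝒦 is Re(w̄F) = 0.

For a line through X of direction T, its second intersections with γ and 𝒦 are compared by a cubic
form in T (`second_intersection_identity`). One factor vanishes on the line XP, because P is common
to both curves; the other is the equation of the tangent of ℋ at P', taken at the second
intersection of the line with Ω. The line XP₀ annihilates the latter. If P₀ = X, the line is tangent
to Ω, and `tangent_derivative_identity` shows that it is not tangent to 𝒦. -/

/-! ### Isogonal conjugacy on the unit circle -/

-- Isogonality makes (p − a)(q − a) / ((b − a)(c − a)) real; replacing conjugates of unit numbers by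
-- inverses clears the factor (a − b)(a − c).
open ComplexConjugate in
theorem isogonal_unit_circle {a b c p q : ℂ} (ha : a * conj a = 1) (hb : b * conj b = 1)
    (hc : c * conj c = 1) (hab : a ≠ b) (hac : a ≠ c)
    (him : ((p - a) * conj (b - a) * ((q - a) * conj (c - a))).im = 0) :
    p * q - a * (p + q) + a ^ 2 = b * c * (a * conj p - 1) * (a * conj q - 1) := by
  have h := Complex.conj_eq_iff_im.2 him
  simp only [map_mul, map_sub, Complex.conj_conj] at h
  have e1 : a * b * (conj b - conj a) = a - b := by linear_combination a * hb - b * ha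
  have e2 : a * c * (conj c - conj a) = a - c := by linear_combination a * hc - c * ha
  have e3 : a * (conj p - conj a) = a * conj p - 1 := by linear_combination - ha
  have e4 : a * (conj q - conj a) = a * conj q - 1 := by linear_combination - ha
  have h1 : (a - b) * (a - c) ≠ 0 := mul_ne_zero (sub_ne_zero.2 hab) (sub_ne_zero.2 hac)
  apply mul_left_cancel₀ h1
  calc (a - b) * (a - c) * (p * q - a * (p + q) + a ^ 2)
      = (p - a) * (a * b * (conj b - conj a)) * ((q - a) * (a * c * (conj c - conj a))) := by
        rw [e1, e2]; ring
    _ = (a * (conj p - conj a)) * (a * (conj q - conj a)) * (b * c) * ((a - b) * (a - c)) := by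
        linear_combination - a ^ 2 * b * c * h
    _ = _ := by rw [e3, e4]; ring

open ComplexConjugate in
/-- In terms of the unit circumcircle, isogonal conjugacy is the vanishing at the vertices of a
complex quadratic function that vanishes at `p`. -/
theorem isogonal_relations {a b c p q : ℂ} (ha : a * conj a = 1) (hb : b * conj b = 1)
    (hc : c * conj c = 1) (hab : a ≠ b) (hbc : b ≠ c) (hca : c ≠ a)
    (hA : ((p - a) * conj (b - a) * ((q - a) * conj (c - a))).im = 0)
    (hB : ((p - b) * conj (c - b) * ((q - b) * conj (a - b))).im = 0) :
    p + q + a * b * c * conj p * conj q = a + b + c ∧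
      p * q + a * b * c * (conj p + conj q) = a * b + b * c + c * a := by
  have h1 := isogonal_unit_circle ha hb hc hab hca.symm hA
  have h2 := isogonal_unit_circle hb hc ha hbc hab.symm hB
  -- The relations at a and b differ by a − b times this one; the third vertex is not needed.
  have h3 : p + q + a * b * c * conj p * conj q = a + b + c := by
    apply mul_left_cancel₀ (sub_ne_zero.2 hab)
    linear_combination h2 - h1
  exact ⟨h3, by linear_combination h1 + a * h3⟩

-- With conj p = 1/p the two relations say that p is a root of the cubic with roots a, b, c. This
-- keeps both P and P' off Ω.
open ComplexConjugate in
theorem eq_vertex_of_unit {a b c p q : ℂ} (hp : p * conj p = 1)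
    (h1 : p + q + a * b * c * conj p * conj q = a + b + c)
    (h2 : p * q + a * b * c * (conj p + conj q) = a * b + b * c + c * a) :
    p = a ∨ p = b ∨ p = c := by
  have : (p - a) * (p - b) * (p - c) = 0 := by
    linear_combination p ^ 2 * h1 - p * h2 - a * b * c * (p * conj q - 1) * hp
  rcases mul_eq_zero.1 this with h | h
  · rcases mul_eq_zero.1 h with h | h
    · exact Or.inl (sub_eq_zero.1 h)
    · exact Or.inr (Or.inl (sub_eq_zero.1 h))
  · exact Or.inr (Or.inr (sub_eq_zero.1 h))

open ComplexConjugate in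
theorem pencil_vanishes {a b c p q : ℂ} (ha : a * conj a = 1)
    (h1 : p + q + a * b * c * conj p * conj q = a + b + c)
    (h2 : p * q + a * b * c * (conj p + conj q) = a * b + b * c + c * a) :
    (a - p) * (a - q) + a * b * c * (conj a - conj p) * (conj q * a - 1) = 0 := by
  linear_combination -a * h1 + h2 + a * b * c * conj q * ha - b * c * ha

/-! ### The pencil of conics through A, B, C, P and double tangency -/

theorem eq_zero_of_affine {α β δ x₁ y₁ x₂ y₂ x₃ y₃ : ℝ}
    (hne : (x₂ - x₁) * (y₃ - y₁) - (x₃ - x₁) * (y₂ - y₁) ≠ 0)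
    (h₁ : α * x₁ + β * y₁ + δ = 0) (h₂ : α * x₂ + β * y₂ + δ = 0)
    (h₃ : α * x₃ + β * y₃ + δ = 0) : α = 0 ∧ β = 0 ∧ δ = 0 := by
  have hα : α = 0 := by
    apply (mul_eq_zero.1 _).resolve_right hne
    linear_combination (y₃ - y₁) * (h₂ - h₁) - (y₂ - y₁) * (h₃ - h₁)
  have hβ : β = 0 := by
    apply (mul_eq_zero.1 _).resolve_right hne
    linear_combination (x₂ - x₁) * (h₃ - h₁) - (x₃ - x₁) * (h₂ - h₁)
  refine ⟨hα, hβ, ?_⟩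
  rw [hα, hβ] at h₁
  linarith

/-- A quadratic function that vanishes at the origin and at three points of the circle with centre
`-(p₁, p₂)` and radius `1` belongs to the pencil spanned by two such functions. -/
theorem mem_pencil {m₁ m₂ n₁ n₂ h p₁ p₂ x₁ y₁ x₂ y₂ x₃ y₃ a b c d e : ℝ}
    (hne : (x₂ - x₁) * (y₃ - y₁) - (x₃ - x₁) * (y₂ - y₁) ≠ 0) (hp : p₁ ^ 2 + p₂ ^ 2 ≠ 1)
    (c₁ : (x₁ + p₁) ^ 2 + (y₁ + p₂) ^ 2 = 1) (c₂ : (x₂ + p₁) ^ 2 + (y₂ + p₂) ^ 2 = 1)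
    (c₃ : (x₃ + p₁) ^ 2 + (y₃ + p₂) ^ 2 = 1)
    (r₁ : x₁ ^ 2 - y₁ ^ 2 - h * x₁ + m₁ * (x₁ ^ 2 + y₁ ^ 2) + n₁ * x₁ + n₂ * y₁ = 0)
    (r₂ : x₂ ^ 2 - y₂ ^ 2 - h * x₂ + m₁ * (x₂ ^ 2 + y₂ ^ 2) + n₁ * x₂ + n₂ * y₂ = 0)
    (r₃ : x₃ ^ 2 - y₃ ^ 2 - h * x₃ + m₁ * (x₃ ^ 2 + y₃ ^ 2) + n₁ * x₃ + n₂ * y₃ = 0)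
    (i₁ : 2 * x₁ * y₁ - h * y₁ + m₂ * (x₁ ^ 2 + y₁ ^ 2) + n₂ * x₁ - n₁ * y₁ = 0)
    (i₂ : 2 * x₂ * y₂ - h * y₂ + m₂ * (x₂ ^ 2 + y₂ ^ 2) + n₂ * x₂ - n₁ * y₂ = 0)
    (i₃ : 2 * x₃ * y₃ - h * y₃ + m₂ * (x₃ ^ 2 + y₃ ^ 2) + n₂ * x₃ - n₁ * y₃ = 0)
    (k₁ : a * x₁ ^ 2 + b * x₁ * y₁ + c * y₁ ^ 2 + d * x₁ + e * y₁ = 0)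
    (k₂ : a * x₂ ^ 2 + b * x₂ * y₂ + c * y₂ ^ 2 + d * x₂ + e * y₂ = 0)
    (k₃ : a * x₃ ^ 2 + b * x₃ * y₃ + c * y₃ ^ 2 + d * x₃ + e * y₃ = 0) :
    ∃ u v : ℝ, a = u * (1 + m₁) - v * m₂ ∧ b = - 2 * v ∧ c = u * (m₁ - 1) - v * m₂ ∧
      d = u * (n₁ - h) - v * n₂ ∧ e = u * n₂ + v * (h + n₁) := by
  obtain ⟨u, hu⟩ : ∃ u, a = c + 2 * u := ⟨(a - c) / 2, by ring⟩
  obtain ⟨v, hv⟩ : ∃ v, b = -2 * v := ⟨-b / 2, by ring⟩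
  obtain ⟨t, ht⟩ : ∃ t, c = u * (m₁ - 1) - v * m₂ + t := ⟨c - (u * (m₁ - 1) - v * m₂), by ring⟩
  obtain ⟨D, hD⟩ : ∃ D, d = u * (n₁ - h) - v * n₂ + D := ⟨d - (u * (n₁ - h) - v * n₂), by ring⟩
  obtain ⟨E, hE⟩ : ∃ E, e = u * n₂ + v * (h + n₁) + E := ⟨e - (u * n₂ + v * (h + n₁)), by ring⟩
  subst hu hv ht hD hE
  -- The choice of u and v leaves the remainder t(x² + y²) + Dx + Ey. On the circle x² + y² is
  -- affine in x and y, so the remainder becomes an affine function with three noncollinear zeros.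
  obtain ⟨z₁, z₂, z₃⟩ := eq_zero_of_affine (α := D - 2 * t * p₁) (β := E - 2 * t * p₂)
    (δ := t * (1 - p₁ ^ 2 - p₂ ^ 2)) hne
    (by linear_combination k₁ - u * r₁ + v * i₁ - t * c₁)
    (by linear_combination k₂ - u * r₂ + v * i₂ - t * c₂)
    (by linear_combination k₃ - u * r₃ + v * i₃ - t * c₃)
  have ht : t = 0 := (mul_eq_zero.1 z₃).resolve_right fun h => hp (by linarith)
  subst ht
  exact ⟨u, v, by ring, by ring, by ring, by linarith, by linarith⟩

/-- A conic through the origin and `(q, 0)` that touches there a circle with centre `(g₁, g₂)`. -/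
theorem bitangent_coefficients {a b d e q g₁ g₂ u₁ u₂ w₁ w₂ : ℝ} (hq : q ≠ 0)
    (hK : a * q ^ 2 + d * q = 0) (hg : (q - g₁) ^ 2 + g₂ ^ 2 = g₁ ^ 2 + g₂ ^ 2)
    (hu : u₁ ≠ 0 ∨ u₂ ≠ 0) (hw : w₁ ≠ 0 ∨ w₂ ≠ 0) (hns : d ≠ 0 ∨ e ≠ 0)
    (ku : d * u₁ + e * u₂ = 0) (gu : u₁ * g₁ + u₂ * g₂ = 0)
    (kw : (2 * a * q + d) * w₁ + (b * q + e) * w₂ = 0)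
    (gw : w₁ * (q - g₁) + w₂ * (0 - g₂) = 0) :
    b = 0 ∧ a ≠ 0 ∧ a * q = - d ∧ 2 * g₁ = q ∧ 2 * a * g₂ = - e := by
  have h1 : 2 * g₁ = q := by
    apply mul_left_cancel₀ hq; linear_combination - hg
  have h2 : a * q = -d := by
    apply mul_left_cancel₀ hq; linear_combination hK
  -- The gradients at the two points are parallel to the radii, which are mirror images in the
  -- perpendicular bisector of the chord. Comparing the two conditions gives b = 0.
  have h3 : d * g₂ = e * g₁ := by
    rcases hu with hu | hu
    · apply mul_left_cancel₀ hu; linear_combination g₂ * ku - e * gu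
    · apply mul_left_cancel₀ hu; linear_combination -g₁ * ku + d * gu
  have h4 : d * g₂ = (b * q + e) * g₁ := by
    rcases hw with hw | hw
    · apply mul_left_cancel₀ hw
      linear_combination -g₂ * kw - (b * q + e) * gw + w₁ * g₂ * 2 * h2 - w₁ * (b * q + e) * h1
    · apply mul_left_cancel₀ hw
      linear_combination (g₁ - q) * kw + (2 * a * q + d) * gw + 2 * w₂ * g₂ * h2
        - w₂ * (b * q + e) * h1
  have hg₁ : g₁ ≠ 0 := by rintro rfl; exact hq (by linarith)
  have hb : b = 0 := by
    apply (mul_eq_zero.1 _).resolve_right (mul_ne_zero hq hg₁)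
    linear_combination h3 - h4
  have hd : d ≠ 0 := by
    rintro rfl
    rcases hns with h | h
    · exact h rfl
    · exact mul_ne_zero h hg₁ (by linarith)
  refine ⟨hb, ?_, h2, h1, ?_⟩
  · rintro rfl; apply hd; linarith
  · apply mul_left_cancel₀ hg₁
    linear_combination -h3 + a * g₂ * h1 + g₂ * h2

/-! ### Polynomial identities at X -/

/-- The identity behind the theorem: it compares the second intersections of a line through `ξ`,
of direction `(x, y)`, with a circle and with a conic of the pencil. -/
theorem second_intersection_identity {p₁ p₂ w₁ w₂ e₁ e₂ h k W m₁ m₂ t n₁ n₂ r x y : ℝ}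
    (hr : r = e₁ ^ 2 + e₂ ^ 2) (hw₁ : w₁ = p₁ + e₁) (hw₂ : w₂ = p₂ + e₂)
    (hk : k = r - p₁ ^ 2 - p₂ ^ 2) (hW : W = w₁ ^ 2 + w₂ ^ 2)
    (hm₁ : m₁ = e₁ * (p₁ + h) + e₂ * p₂) (hm₂ : m₂ = e₂ * (p₁ + h) - e₁ * p₂)
    (ht : t = h * p₁ - k) (hn₁ : n₁ = e₁ * t - e₂ * (h * p₂)) (hn₂ : n₂ = e₁ * (h * p₂) + e₂ * t) :
    (2 * (r + m₁) * k * (w₁ * x + w₂ * y) + W * ((n₁ - r * h) * x + n₂ * y)) *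
        ((w₁ * (r + m₁) + w₂ * m₂) * x ^ 2 + r * 2 * w₂ * x * y +
          (w₁ * (m₁ - r) + w₂ * m₂) * y ^ 2) -
      ((2 * (w₁ * (r + m₁) + w₂ * m₂) * (k * w₁) + r * 2 * w₂ * (k * w₂)
            + W * (w₁ * (n₁ - r * h) + w₂ * n₂)) * x +
          (r * 2 * w₂ * (k * w₁) + 2 * (w₁ * (m₁ - r) + w₂ * m₂) * (k * w₂)
            + W * (w₁ * n₂ - w₂ * (r * h + n₁))) * y) * (r + m₁) * (x ^ 2 + y ^ 2) =
    r * (x * w₂ - y * w₁) *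
      (h * w₂ * ((x ^ 2 + y ^ 2) * (k * w₁ - W * h)
          - 2 * ((k * w₁ + W * p₁) * x + (k * w₂ + W * p₂) * y) * x)
        + (t - e₁ * h) * ((x ^ 2 + y ^ 2) * (k * w₂)
          - 2 * ((k * w₁ + W * p₁) * x + (k * w₂ + W * p₂) * y) * y)) := by
  -- Writing r for the constant 1 = e₁² + e₂² turns this into a pure polynomial identity.
  subst hn₁ hn₂ ht hm₁ hm₂ hW hk hr hw₁ hw₂
  ring

/-- The derivative of the same conic at `ξ` along the tangent of the circumcircle. -/
theorem tangent_derivative_identity {p₁ p₂ w₁ w₂ e₁ e₂ h k W m₁ m₂ t n₁ n₂ r : ℝ}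
    (hr : r = e₁ ^ 2 + e₂ ^ 2) (hw₁ : w₁ = p₁ + e₁) (hw₂ : w₂ = p₂ + e₂)
    (hk : k = r - p₁ ^ 2 - p₂ ^ 2) (hW : W = w₁ ^ 2 + w₂ ^ 2)
    (hm₁ : m₁ = e₁ * (p₁ + h) + e₂ * p₂) (hm₂ : m₂ = e₂ * (p₁ + h) - e₁ * p₂)
    (ht : t = h * p₁ - k) (hn₁ : n₁ = e₁ * t - e₂ * (h * p₂)) (hn₂ : n₂ = e₁ * (h * p₂) + e₂ * t) :
    (2 * (w₁ * (r + m₁) + w₂ * m₂) * (k * w₁) + r * 2 * w₂ * (k * w₂)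
            + W * (w₁ * (n₁ - r * h) + w₂ * n₂)) * -(k * w₂ + W * p₂) +
          (r * 2 * w₂ * (k * w₁) + 2 * (w₁ * (m₁ - r) + w₂ * m₂) * (k * w₂)
            + W * (w₁ * n₂ - w₂ * (r * h + n₁))) * (k * w₁ + W * p₁) =
      -(r * k ^ 2 * w₂ * W) := by
  subst hn₁ hn₂ ht hm₁ hm₂ hW hk hr hw₁ hw₂
  ring

/-- The values at `ξ` of the two functions that span the pencil. -/
theorem pencil_value_identities {p₁ p₂ w₁ w₂ e₁ e₂ h k W m₁ m₂ t n₁ n₂ r : ℝ}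
    (hr : r = e₁ ^ 2 + e₂ ^ 2) (hw₁ : w₁ = p₁ + e₁) (hw₂ : w₂ = p₂ + e₂)
    (hk : k = r - p₁ ^ 2 - p₂ ^ 2) (hW : W = w₁ ^ 2 + w₂ ^ 2)
    (hm₁ : m₁ = e₁ * (p₁ + h) + e₂ * p₂) (hm₂ : m₂ = e₂ * (p₁ + h) - e₁ * p₂)
    (ht : t = h * p₁ - k) (hn₁ : n₁ = e₁ * t - e₂ * (h * p₂)) (hn₂ : n₂ = e₁ * (h * p₂) + e₂ * t) :
    (r * ((k * w₁) ^ 2 - (k * w₂) ^ 2) - r * h * (k * w₁) * W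
          + m₁ * ((k * w₁) ^ 2 + (k * w₂) ^ 2) + W * (n₁ * (k * w₁) + n₂ * (k * w₂)) =
        -(2 * r * k ^ 2 * w₂ ^ 2)) ∧
      (r * 2 * (k * w₁) * (k * w₂) - r * h * (k * w₂) * W
          + m₂ * ((k * w₁) ^ 2 + (k * w₂) ^ 2) + W * (n₂ * (k * w₁) - n₁ * (k * w₂)) =
        2 * r * k ^ 2 * w₁ * w₂) := by
  subst hn₁ hn₂ ht hm₁ hm₂ hW hk hr hw₁ hw₂
  constructor <;> ring

/-! ### Lines, circles and conics in coordinates -/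

theorem inner_plane (u v : Plane) : inner ℝ u v = u 0 * v 0 + u 1 * v 1 := by
  simp [PiLp.inner_apply, Fin.sum_univ_two, mul_comm]

theorem plane_ext {Z W : Plane} (h0 : Z 0 = W 0) (h1 : Z 1 = W 1) : Z = W := by
  ext i; fin_cases i
  · exact h0
  · exact h1

theorem sq_add_sq_eq_of_mem_sphere {γ : Sphere Plane} {Z : Plane} (h : Z ∈ γ) :
    (Z 0 - γ.center 0) ^ 2 + (Z 1 - γ.center 1) ^ 2 = γ.radius ^ 2 := by
  rw [EuclideanGeometry.mem_sphere, EuclideanSpace.dist_eq] at h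
  rw [← h, Real.sq_sqrt (Finset.sum_nonneg fun _ _ => sq_nonneg _)]
  simp [Fin.sum_univ_two, Real.dist_eq, sq_abs]

theorem mem_sphere_of_sq_add_sq {γ : Sphere Plane} {Z : Plane} (hr : 0 ≤ γ.radius)
    (h : (Z 0 - γ.center 0) ^ 2 + (Z 1 - γ.center 1) ^ 2 = γ.radius ^ 2) : Z ∈ γ := by
  rw [EuclideanGeometry.mem_sphere, EuclideanSpace.dist_eq, ← Real.sqrt_sq hr, ← h]
  simp [Fin.sum_univ_two, Real.dist_eq, sq_abs]

theorem mem_line_iff {A B Z : Plane} :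
    Z ∈ line[ℝ, A, B] ↔ ∃ r : ℝ, Z = A + r • (B - A) := by
  rw [mem_affineSpan_pair_iff_exists_lineMap_eq]
  constructor
  · rintro ⟨r, rfl⟩; exact ⟨r, by simp [AffineMap.lineMap_apply, add_comm]⟩
  · rintro ⟨r, rfl⟩; exact ⟨r, by simp [AffineMap.lineMap_apply, add_comm]⟩

theorem mem_line_of_cross_eq_zero {A B Z : Plane} (hAB : A ≠ B)
    (h : cross (Z - A) (B - A) = 0) : Z ∈ line[ℝ, A, B] := by
  have hN : (B 0 - A 0) ^ 2 + (B 1 - A 1) ^ 2 ≠ 0 := by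
    intro h0
    exact hAB (plane_ext (by nlinarith [sq_nonneg (B 1 - A 1)]) (by nlinarith [sq_nonneg (B 0 - A 0)]))
  simp only [cross, PiLp.sub_apply] at h
  refine mem_line_iff.2 ⟨((Z 0 - A 0) * (B 0 - A 0) + (Z 1 - A 1) * (B 1 - A 1)) /
    ((B 0 - A 0) ^ 2 + (B 1 - A 1) ^ 2), plane_ext ?_ ?_⟩
  · simp only [PiLp.add_apply, PiLp.smul_apply, PiLp.sub_apply, smul_eq_mul]
    field_simp
    linear_combination (B 1 - A 1) * h
  · simp only [PiLp.add_apply, PiLp.smul_apply, PiLp.sub_apply, smul_eq_mul]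
    field_simp
    linear_combination -(B 0 - A 0) * h

theorem cross_ne_zero_of_affineIndependent {A B C : Plane}
    (h : AffineIndependent ℝ ![A, B, C]) : cross (C - A) (B - A) ≠ 0 := by
  intro h0
  have hAB : A ≠ B := fun hAB => by
    simpa using h.injective.ne (show (0 : Fin 3) ≠ 1 by decide) hAB
  rw [affineIndependent_iff_not_collinear_set] at h
  apply h
  obtain ⟨r, hr⟩ := mem_line_iff.1 (mem_line_of_cross_eq_zero hAB h0)
  rw [collinear_iff_of_mem (p₀ := A) (by simp)]
  refine ⟨B - A, ?_⟩
  rintro Z (rfl | rfl | rfl)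
  · exact ⟨0, by simp⟩
  · exact ⟨1, by simp⟩
  · exact ⟨r, by rw [hr]; simp [add_comm]⟩

theorem isTangentAt_sphere_of_inner {γ : Sphere Plane} {X : Plane} {ℓ : AffineSubspace ℝ Plane}
    (hX : X ∈ γ) (hℓ : X ∈ ℓ)
    (h : ∀ Z ∈ ℓ, (Z 0 - X 0) * (X 0 - γ.center 0) + (Z 1 - X 1) * (X 1 - γ.center 1) = 0) :
    γ.IsTangentAt X ℓ := by
  refine ⟨hX, hℓ, fun Z hZ => ?_⟩
  rw [Sphere.mem_orthRadius_iff_inner_left, inner_plane]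
  simpa using h Z hZ

theorem inner_eq_zero_of_isTangentAt {γ : Sphere Plane} {X Z : Plane}
    {ℓ : AffineSubspace ℝ Plane} (h : γ.IsTangentAt X ℓ) (hZ : Z ∈ ℓ) :
    (Z 0 - X 0) * (X 0 - γ.center 0) + (Z 1 - X 1) * (X 1 - γ.center 1) = 0 := by
  have := h.inner_left_eq_zero_of_mem hZ
  rw [inner_plane] at this
  simpa using this

namespace Conic

/-- The quadratic part of the equation of the conic. -/
def quad (K : Conic) (v : Plane) : ℝ := K.a * v 0 ^ 2 + K.b * v 0 * v 1 + K.c * v 1 ^ 2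

theorem mem_iff {K : Conic} {Z : Plane} : Z ∈ K ↔ K.eval Z = 0 := Iff.rfl

theorem eval_add_smul (K : Conic) (X v : Plane) (t : ℝ) :
    K.eval (X + t • v) = K.eval X + t * K.dirDeriv X v + t ^ 2 * K.quad v := by
  simp only [eval, dirDeriv, quad, PiLp.add_apply, PiLp.smul_apply, smul_eq_mul]; ring

theorem dirDeriv_smul (K : Conic) (X v : Plane) (t : ℝ) :
    K.dirDeriv X (t • v) = t * K.dirDeriv X v := by
  simp only [dirDeriv, PiLp.smul_apply, smul_eq_mul]; ring

theorem not_line_of_isNondegenerate {K : Conic} (hK : K.IsNondegenerate) {P v : Plane}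
    (hv : v ≠ 0) (h0 : K.eval P = 0) (h1 : K.dirDeriv P v = 0) : K.quad v ≠ 0 := by
  intro h2
  apply hK
  simp only [eval, dirDeriv, quad] at h0 h1 h2
  have hN : v 0 ^ 2 + v 1 ^ 2 ≠ 0 := fun hN => hv (plane_ext
    (by simpa using (by nlinarith [sq_nonneg (v 1)] : v 0 = 0))
    (by simpa using (by nlinarith [sq_nonneg (v 0)] : v 1 = 0)))
  apply (mul_eq_zero.1 _).resolve_left (pow_ne_zero 2 hN)
  -- α, β, δ, x, y/2 and `K.quad v` are the entries of the conic's matrix in the homogeneous basis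
  -- v, v rotated by a right angle, P.
  obtain ⟨α, hα⟩ : ∃ α, α = K.c * v 0 * v 1 - K.a * v 0 * v 1 + K.b / 2 * (v 0 ^ 2 - v 1 ^ 2) :=
    ⟨_, rfl⟩
  obtain ⟨β, hβ⟩ : ∃ β, β = ((K.b * P 0 + 2 * K.c * P 1 + K.e) * v 0 -
    (2 * K.a * P 0 + K.b * P 1 + K.d) * v 1) / 2 := ⟨_, rfl⟩
  obtain ⟨δ, hδ⟩ : ∃ δ, δ = K.a * v 1 ^ 2 - K.b * v 0 * v 1 + K.c * v 0 ^ 2 := ⟨_, rfl⟩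
  obtain ⟨x, hx⟩ : ∃ x, x = K.eval P := ⟨_, rfl⟩
  obtain ⟨y, hy⟩ : ∃ y, y = K.dirDeriv P v := ⟨_, rfl⟩
  have key : (v 0 ^ 2 + v 1 ^ 2) ^ 2 *
      (!![K.a, K.b / 2, K.d / 2; K.b / 2, K.c, K.e / 2; K.d / 2, K.e / 2, K.f]).det =
      K.quad v * (x * δ - β ^ 2) - y / 2 * (y / 2 * δ - α * β) + α * (y / 2 * β - x * α) := by
    subst hα hβ hδ hx hy
    rw [Matrix.det_fin_three]
    simp [eval, dirDeriv, quad]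
    ring
  rw [key, hx, hy]
  simp only [eval, dirDeriv, quad, h0, h1, h2]
  ring

end Conic

/-! ### Change of coordinates by a similarity -/

/-- Multiplication of plane vectors as complex numbers. -/
def turn (v w : Plane) : Plane := !₂[v 0 * w 0 - v 1 * w 1, v 1 * w 0 + v 0 * w 1]

@[simp] theorem turn_zero (v w : Plane) : turn v w 0 = v 0 * w 0 - v 1 * w 1 := rfl
@[simp] theorem turn_one (v w : Plane) : turn v w 1 = v 1 * w 0 + v 0 * w 1 := rfl

/-- The similarity that sends the origin to `P` and the first unit vector to `P + v`. -/
def frame (P v w : Plane) : Plane := P + turn v w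

@[simp] theorem frame_zero (P v w : Plane) :
    frame P v w 0 = P 0 + (v 0 * w 0 - v 1 * w 1) := rfl
@[simp] theorem frame_one (P v w : Plane) :
    frame P v w 1 = P 1 + (v 1 * w 0 + v 0 * w 1) := rfl

/-- The coordinates of `Z` with respect to `frame P v`. -/
noncomputable def coords (P v Z : Plane) : Plane :=
  !₂[(v 0 * (Z 0 - P 0) + v 1 * (Z 1 - P 1)) / (v 0 ^ 2 + v 1 ^ 2),
    (v 0 * (Z 1 - P 1) - v 1 * (Z 0 - P 0)) / (v 0 ^ 2 + v 1 ^ 2)]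

theorem frame_coords {v : Plane} (hv : v 0 ^ 2 + v 1 ^ 2 ≠ 0) (P Z : Plane) :
    frame P v (coords P v Z) = Z := by
  apply plane_ext <;> simp [coords] <;> field_simp <;> ring

theorem turn_coords {v : Plane} (hv : v 0 ^ 2 + v 1 ^ 2 ≠ 0) (T : Plane) :
    turn v (coords 0 v T) = T := by
  apply plane_ext <;> simp [coords] <;> field_simp <;> ring

theorem turn_ne_zero {v w : Plane} (h : turn v w ≠ 0) : w 0 ≠ 0 ∨ w 1 ≠ 0 := by
  by_contra! hw
  exact h (plane_ext (by simp [hw]) (by simp [hw]))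

namespace Conic

/-- The equation of the conic in the coordinates of `frame P v`. -/
def pull (K : Conic) (P v : Plane) (hv : v 0 ^ 2 + v 1 ^ 2 ≠ 0) : Conic where
  a := K.a * v 0 ^ 2 + K.b * v 0 * v 1 + K.c * v 1 ^ 2
  b := -2 * K.a * v 0 * v 1 + K.b * (v 0 ^ 2 - v 1 ^ 2) + 2 * K.c * v 0 * v 1
  c := K.a * v 1 ^ 2 - K.b * v 0 * v 1 + K.c * v 0 ^ 2
  d := (2 * K.a * P 0 + K.b * P 1 + K.d) * v 0 + (K.b * P 0 + 2 * K.c * P 1 + K.e) * v 1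
  e := (K.b * P 0 + 2 * K.c * P 1 + K.e) * v 0 - (2 * K.a * P 0 + K.b * P 1 + K.d) * v 1
  f := K.eval P
  quad_ne := by
    by_contra! h
    obtain ⟨h1, h2, h3⟩ := h
    have hN := pow_ne_zero 2 hv
    rcases K.quad_ne with h | h | h <;> apply h <;> apply (mul_eq_zero.1 _).resolve_left hN
    · linear_combination v 0 ^ 2 * h1 - v 0 * v 1 * h2 + v 1 ^ 2 * h3
    · linear_combination 2 * v 0 * v 1 * h1 + (v 0 ^ 2 - v 1 ^ 2) * h2 - 2 * v 0 * v 1 * h3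
    · linear_combination v 1 ^ 2 * h1 + v 0 * v 1 * h2 + v 0 ^ 2 * h3

theorem eval_frame (K : Conic) (P v : Plane) (hv : v 0 ^ 2 + v 1 ^ 2 ≠ 0) (w : Plane) :
    K.eval (frame P v w) = (K.pull P v hv).eval w := by
  simp [eval, pull]; ring

theorem dirDeriv_frame (K : Conic) (P v : Plane) (hv : v 0 ^ 2 + v 1 ^ 2 ≠ 0) (w τ : Plane) :
    K.dirDeriv (frame P v w) (turn v τ) = (K.pull P v hv).dirDeriv w τ := by
  simp [dirDeriv, pull]; ring

theorem quad_turn (K : Conic) (P v : Plane) (hv : v 0 ^ 2 + v 1 ^ 2 ≠ 0) (τ : Plane) :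
    K.quad (turn v τ) = (K.pull P v hv).quad τ := by
  simp [quad, pull]; ring

/-- Every equation in the coordinates of `frame P v` is that of a conic. -/
theorem exists_push (L : Conic) (P v : Plane) (hv : v 0 ^ 2 + v 1 ^ 2 ≠ 0) :
    ∃ K : Conic, (∀ w, K.eval (frame P v w) = L.eval w) ∧
      (∀ w τ, K.dirDeriv (frame P v w) (turn v τ) = L.dirDeriv w τ) ∧
      ∀ τ, K.quad (turn v τ) = L.quad τ := by
  -- v' is the complex inverse of v, so the equation is pulled back along the inverse similarity.
  obtain ⟨v', h0, h1⟩ : ∃ v' : Plane, v' 0 = v 0 / (v 0 ^ 2 + v 1 ^ 2) ∧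
      v' 1 = -v 1 / (v 0 ^ 2 + v 1 ^ 2) := ⟨!₂[_, _], rfl, rfl⟩
  have hv' : v' 0 ^ 2 + v' 1 ^ 2 ≠ 0 := by
    rw [h0, h1]
    have : (v 0 / (v 0 ^ 2 + v 1 ^ 2)) ^ 2 + (-v 1 / (v 0 ^ 2 + v 1 ^ 2)) ^ 2 =
      (v 0 ^ 2 + v 1 ^ 2)⁻¹ := by field_simp
    rw [this]
    exact inv_ne_zero hv
  have ht : ∀ τ, turn v' (turn v τ) = τ := fun τ => by
    apply plane_ext <;> simp [h0, h1] <;> field_simp <;> ring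
  have hf : ∀ w, frame (-turn v' P) v' (frame P v w) = w := fun w => by
    apply plane_ext <;> simp [h0, h1] <;> field_simp <;> ring
  refine ⟨L.pull (-turn v' P) v' hv', fun w => ?_, fun w τ => ?_, fun τ => ?_⟩
  · rw [← eval_frame, hf]
  · rw [← dirDeriv_frame, hf, ht]
  · rw [← quad_turn, ht]

/-- Tangency of a conic and a circle, in coordinates. -/
theorem IsTangentToCircleAt.exists_direction {K : Conic} {γ : Sphere Plane} {T : Plane}
    (h : K.IsTangentToCircleAt γ T) :
    K.eval T = 0 ∧ T ∈ γ ∧ (∃ u, K.dirDeriv T u ≠ 0) ∧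
      ∃ u : Plane, u ≠ 0 ∧ K.dirDeriv T u = 0 ∧
        u 0 * (T 0 - γ.center 0) + u 1 * (T 1 - γ.center 1) = 0 := by
  obtain ⟨U, hU, ⟨h1, h2, -, h3⟩, h4⟩ := h
  have hUm : U ∈ line[ℝ, T, U] := right_mem_affineSpan_pair ℝ T U
  refine ⟨h1, h4.mem_sphere, h2, U - T, sub_ne_zero.2 hU, h3 U hUm, ?_⟩
  simpa using inner_eq_zero_of_isTangentAt h4 hUm

end Conic

/-! ### Second intersections and their limiting cases -/

/-- The three cases of the conclusion, from a proportionality of two quadratic functions. -/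
theorem second_intersection_cases {Ω γ : Sphere Plane} {K : Conic} {X P₀ : Plane}
    (hΩ : Ω.radius ≠ 0) (hX : X ∈ Ω) (hXγ : X ∈ γ) (hXK : X ∈ K) (hP₀ : P₀ ∈ Ω)
    (h1 : ∀ T : Plane,
      (∀ i, (T 0 ^ 2 + T 1 ^ 2) * (P₀ i - X i) =
        -2 * ((X 0 - Ω.center 0) * T 0 + (X 1 - Ω.center 1) * T 1) * T i) →
      K.quad T * (2 * ((X 0 - γ.center 0) * T 0 + (X 1 - γ.center 1) * T 1)) =
        K.dirDeriv X T * (T 0 ^ 2 + T 1 ^ 2))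
    (h2 : ∀ T : Plane, T ≠ 0 → (X 0 - Ω.center 0) * T 0 + (X 1 - Ω.center 1) * T 1 = 0 →
      K.dirDeriv X T ≠ 0) :
    (P₀ ≠ X → ¬ γ.IsTangentAt X line[ℝ, P₀, X] →
      ∃ Z ∈ line[ℝ, P₀, X], Z ≠ X ∧ Z ∈ γ ∧ Z ∈ K) ∧
    (P₀ ≠ X → γ.IsTangentAt X line[ℝ, P₀, X] → K.IsTangentAt X line[ℝ, P₀, X]) ∧
    (P₀ = X → ∃ Z, Z ≠ X ∧ Ω.IsTangentAt X line[ℝ, X, Z] ∧ Z ∈ γ ∧ Z ∈ K) := by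
  have hXΩ' := sq_add_sq_eq_of_mem_sphere hX
  have hXγ' := sq_add_sq_eq_of_mem_sphere hXγ
  have hP₀' := sq_add_sq_eq_of_mem_sphere hP₀
  have hγr : 0 ≤ γ.radius := by rw [← EuclideanGeometry.mem_sphere.1 hXγ]; exact dist_nonneg
  have hn : ∀ {T : Plane}, T ≠ 0 → T 0 ^ 2 + T 1 ^ 2 ≠ 0 := fun {T} hT h => hT (plane_ext
    (by simpa using (by nlinarith [sq_nonneg (T 1)] : T 0 = 0))
    (by simpa using (by nlinarith [sq_nonneg (T 0)] : T 1 = 0)))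
  have hns : ∃ v, K.dirDeriv X v ≠ 0 := by
    refine ⟨!₂[-(X 1 - Ω.center 1), X 0 - Ω.center 0], h2 _ ?_ ?_⟩
    · intro h
      have e0 := congrArg (fun v : Plane => v 0) h
      have e1 := congrArg (fun v : Plane => v 1) h
      simp at e0 e1
      apply hΩ
      apply pow_eq_zero_iff (two_ne_zero) |>.1
      rw [← hXΩ', e1]
      linear_combination (Ω.center 1 - X 1) * e0
    · simp; ring
  -- The line X + tT meets γ again at t = −2(X − G)·T / |T|², with G the centre of γ; the
  -- proportionality makes the same t a root of the equation of `K`.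
  have second : ∀ T : Plane, T ≠ 0 →
      (X 0 - γ.center 0) * T 0 + (X 1 - γ.center 1) * T 1 ≠ 0 →
      K.quad T * (2 * ((X 0 - γ.center 0) * T 0 + (X 1 - γ.center 1) * T 1)) =
        K.dirDeriv X T * (T 0 ^ 2 + T 1 ^ 2) →
      ∃ t : ℝ, X + t • T ≠ X ∧ X + t • T ∈ γ ∧ X + t • T ∈ K := by
    intro T hT hd hk
    have hN := hn hT
    obtain ⟨t, ht⟩ : ∃ t : ℝ, t * (T 0 ^ 2 + T 1 ^ 2) =
        -2 * ((X 0 - γ.center 0) * T 0 + (X 1 - γ.center 1) * T 1) :=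
      ⟨_, div_mul_cancel₀ _ hN⟩
    have ht0 : t ≠ 0 := by
      rintro rfl
      exact hd (by linarith)
    refine ⟨t, ?_, mem_sphere_of_sq_add_sq hγr ?_, ?_⟩
    · simpa using ⟨ht0, hT⟩
    · simp only [PiLp.add_apply, PiLp.smul_apply, smul_eq_mul]
      linear_combination hXγ' + t * ht
    · rw [Conic.mem_iff, K.eval_add_smul, Conic.mem_iff.1 hXK]
      apply mul_left_cancel₀ hN
      linear_combination -t * hk + t * K.quad T * ht
  -- As P₀ and X both lie on Ω, the direction P₀ − X satisfies the condition in `h1`.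
  have hP : P₀ ≠ X → K.quad (P₀ - X) * (2 * ((X 0 - γ.center 0) * (P₀ - X) 0 +
      (X 1 - γ.center 1) * (P₀ - X) 1)) =
        K.dirDeriv X (P₀ - X) * ((P₀ - X) 0 ^ 2 + (P₀ - X) 1 ^ 2) := by
    intro hne
    apply h1
    intro i
    simp only [PiLp.sub_apply]
    linear_combination (P₀ i - X i) * (hP₀' - hXΩ')
  refine ⟨fun hne hnt => ?_, fun hne ht => ?_, fun he => ?_⟩
  · have hd : (X 0 - γ.center 0) * (P₀ - X) 0 + (X 1 - γ.center 1) * (P₀ - X) 1 ≠ 0 := by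
      intro hd
      apply hnt
      refine isTangentAt_sphere_of_inner hXγ (right_mem_affineSpan_pair ℝ _ _) fun Z hZ => ?_
      obtain ⟨r, rfl⟩ := mem_line_iff.1 hZ
      simp only [PiLp.add_apply, PiLp.smul_apply, PiLp.sub_apply, smul_eq_mul] at hd ⊢
      linear_combination (1 - r) * hd
    obtain ⟨t, h⟩ := second _ (sub_ne_zero.2 hne) hd (hP hne)
    refine ⟨_, mem_line_iff.2 ⟨1 - t, ?_⟩, h⟩
    module
  · have hd := inner_eq_zero_of_isTangentAt ht (left_mem_affineSpan_pair ℝ _ _)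
    have hk := hP hne
    have hT : K.dirDeriv X (P₀ - X) = 0 := by
      apply (mul_eq_zero.1 _).resolve_right (hn (sub_ne_zero.2 hne))
      rw [← hk]
      simp only [PiLp.sub_apply]
      linear_combination 2 * K.quad (P₀ - X) * hd
    refine ⟨hXK, hns, ht.mem_space, fun Z hZ => ?_⟩
    obtain ⟨r, rfl⟩ := mem_line_iff.1 hZ
    have : P₀ + r • (X - P₀) - X = (1 - r) • (P₀ - X) := by module
    rw [this, K.dirDeriv_smul, hT, mul_zero]
  · subst he
    set T : Plane := !₂[-(P₀ 1 - Ω.center 1), P₀ 0 - Ω.center 0] with hTdef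
    have t0 : T 0 = -(P₀ 1 - Ω.center 1) := rfl
    have t1 : T 1 = P₀ 0 - Ω.center 0 := rfl
    have hTn : T 0 ^ 2 + T 1 ^ 2 ≠ 0 := by
      rw [t0, t1]
      intro h
      apply hΩ
      apply pow_eq_zero_iff (two_ne_zero) |>.1
      rw [← hXΩ', ← h]; ring
    have hT : T ≠ 0 := by
      intro h
      apply hTn
      simp [h]
    have hΩT : (P₀ 0 - Ω.center 0) * T 0 + (P₀ 1 - Ω.center 1) * T 1 = 0 := by
      rw [t0, t1]; ring
    -- For P₀ = X both sides of the condition in `h1` vanish along the tangent of Ω.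
    have hk := h1 T fun i => by rw [hΩT]; ring
    have hd : (P₀ 0 - γ.center 0) * T 0 + (P₀ 1 - γ.center 1) * T 1 ≠ 0 := by
      intro h
      rw [h] at hk
      exact mul_ne_zero (h2 T hT hΩT) hTn (by rw [← hk]; ring)
    obtain ⟨t, h3, h4⟩ := second T hT hd hk
    refine ⟨_, h3, ?_, h4⟩
    refine isTangentAt_sphere_of_inner hX (left_mem_affineSpan_pair ℝ _ _) fun Z hZ => ?_
    obtain ⟨r, rfl⟩ := mem_line_iff.1 hZ
    simp only [PiLp.add_apply, PiLp.smul_apply, PiLp.sub_apply, smul_eq_mul]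
    linear_combination r * t * hΩT

/-! ### The configuration in normal form -/

/-- The point `z` lies on the unit circle with centre `-p`, and the two functions that span the
pencil vanish at `z`. -/
structure IsBasePoint (p : Plane) (h m₁ m₂ n₁ n₂ : ℝ) (z : Plane) : Prop where
  circle : (z 0 + p 0) ^ 2 + (z 1 + p 1) ^ 2 = 1
  re : z 0 ^ 2 - z 1 ^ 2 - h * z 0 + m₁ * (z 0 ^ 2 + z 1 ^ 2) + n₁ * z 0 + n₂ * z 1 = 0
  im : 2 * z 0 * z 1 - h * z 1 + m₂ * (z 0 ^ 2 + z 1 ^ 2) + n₂ * z 0 - n₁ * z 1 = 0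

theorem exists_frame {P P' : Plane} (hne : P ≠ P') {R : ℝ} (hR : R ≠ 0) :
    ∃ (v : Plane) (h : ℝ), v 0 ^ 2 + v 1 ^ 2 = R ^ 2 ∧ h ≠ 0 ∧ P' = frame P v !₂[h, 0] := by
  have hn : ‖P' - P‖ ≠ 0 := norm_ne_zero_iff.2 (sub_ne_zero.2 hne.symm)
  have hn2 : ‖P' - P‖ ^ 2 = (P' 0 - P 0) ^ 2 + (P' 1 - P 1) ^ 2 := by
    rw [← real_inner_self_eq_norm_sq, inner_plane]
    simp only [PiLp.sub_apply]; ring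
  refine ⟨(R / ‖P' - P‖) • (P' - P), ‖P' - P‖ / R, ?_, div_ne_zero hn hR, ?_⟩
  · simp only [PiLp.smul_apply, PiLp.sub_apply, smul_eq_mul]
    field_simp
    rw [hn2]
  · apply plane_ext <;> simp <;> field_simp <;> ring

open ComplexConjugate in
theorem exists_pencil {p a b c : Plane} {h : ℝ}
    (ha : (a 0 + p 0) ^ 2 + (a 1 + p 1) ^ 2 = 1) (hb : (b 0 + p 0) ^ 2 + (b 1 + p 1) ^ 2 = 1)
    (hc : (c 0 + p 0) ^ 2 + (c 1 + p 1) ^ 2 = 1) (hab : a ≠ b) (hbc : b ≠ c) (hca : c ≠ a)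
    (ha0 : a ≠ 0) (hb0 : b ≠ 0) (hc0 : c ≠ 0)
    (hah : a ≠ !₂[h, 0]) (hbh : b ≠ !₂[h, 0]) (hch : c ≠ !₂[h, 0])
    (hA : SameDirectedAngle (b - a) (0 - a) (!₂[h, 0] - a) (c - a))
    (hB : SameDirectedAngle (c - b) (0 - b) (!₂[h, 0] - b) (a - b)) :
    ∃ e₁ e₂ m₁ m₂ n₁ n₂ t : ℝ, e₁ ^ 2 + e₂ ^ 2 = 1 ∧
      m₁ = e₁ * (p 0 + h) + e₂ * p 1 ∧ m₂ = e₂ * (p 0 + h) - e₁ * p 1 ∧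
      t = h * p 0 - (1 - p 0 ^ 2 - p 1 ^ 2) ∧ n₁ = e₁ * t - e₂ * (h * p 1) ∧
      n₂ = e₁ * (h * p 1) + e₂ * t ∧
      p 0 ^ 2 + p 1 ^ 2 ≠ 1 ∧ (p 0 + h) ^ 2 + p 1 ^ 2 ≠ 1 ∧
      IsBasePoint p h m₁ m₂ n₁ n₂ a ∧ IsBasePoint p h m₁ m₂ n₁ n₂ b ∧
      IsBasePoint p h m₁ m₂ n₁ n₂ c := by
  have unit : ∀ {x y : ℝ}, x ^ 2 + y ^ 2 = 1 → (⟨x, y⟩ : ℂ) * conj (⟨x, y⟩ : ℂ) = 1 := by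
    intro x y hxy
    apply Complex.ext <;> simp
    · linear_combination hxy
    · ring
  have cne : ∀ {z w : Plane}, z ≠ w → (⟨z 0 + p 0, z 1 + p 1⟩ : ℂ) ≠ ⟨w 0 + p 0, w 1 + p 1⟩ := by
    intro z w hzw heq
    have := Complex.ext_iff.1 heq
    exact hzw (plane_ext (by simpa using this.1) (by simpa using this.2))
  have him : ∀ {x y z : Plane}, SameDirectedAngle (y - x) (0 - x) (!₂[h, 0] - x) (z - x) →
      (((⟨p 0, p 1⟩ : ℂ) - ⟨x 0 + p 0, x 1 + p 1⟩) *
        conj ((⟨y 0 + p 0, y 1 + p 1⟩ : ℂ) - ⟨x 0 + p 0, x 1 + p 1⟩) *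
        (((⟨p 0 + h, p 1⟩ : ℂ) - ⟨x 0 + p 0, x 1 + p 1⟩) *
        conj ((⟨z 0 + p 0, z 1 + p 1⟩ : ℂ) - ⟨x 0 + p 0, x 1 + p 1⟩))).im = 0 := by
    intro x y z hx
    simp [SameDirectedAngle, cross, inner_plane] at hx
    simp
    linear_combination hx
  have uA := unit ha
  have uB := unit hb
  have uC := unit hc
  obtain ⟨h1, h2⟩ := isogonal_relations uA uB uC (cne hab) (cne hbc) (cne hca) (him hA) (him hB)
  have vA := pencil_vanishes uA h1 h2
  have vB := pencil_vanishes (p := ⟨p 0, p 1⟩) (q := ⟨p 0 + h, p 1⟩) (b := ⟨c 0 + p 0, c 1 + p 1⟩) (c := ⟨a 0 + p 0, a 1 + p 1⟩) uB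
    (by linear_combination h1) (by linear_combination h2)
  have vC := pencil_vanishes (p := ⟨p 0, p 1⟩) (q := ⟨p 0 + h, p 1⟩) (b := ⟨a 0 + p 0, a 1 + p 1⟩) (c := ⟨b 0 + p 0, b 1 + p 1⟩) uC
    (by linear_combination h1) (by linear_combination h2)
  obtain ⟨e, he⟩ : ∃ e : ℂ, e = (⟨a 0 + p 0, a 1 + p 1⟩ : ℂ) * ⟨b 0 + p 0, b 1 + p 1⟩ *
    ⟨c 0 + p 0, c 1 + p 1⟩ := ⟨_, rfl⟩
  have ue : e * conj e = 1 := by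
    rw [he, map_mul, map_mul]
    linear_combination
      (⟨b 0 + p 0, b 1 + p 1⟩ : ℂ) * conj (⟨b 0 + p 0, b 1 + p 1⟩ : ℂ) *
        ((⟨c 0 + p 0, c 1 + p 1⟩ : ℂ) * conj (⟨c 0 + p 0, c 1 + p 1⟩ : ℂ)) * uA +
      ((⟨c 0 + p 0, c 1 + p 1⟩ : ℂ) * conj (⟨c 0 + p 0, c 1 + p 1⟩ : ℂ)) * uB + uC
  rw [← he] at vA
  rw [show (⟨b 0 + p 0, b 1 + p 1⟩ : ℂ) * ⟨c 0 + p 0, c 1 + p 1⟩ * ⟨a 0 + p 0, a 1 + p 1⟩ = e by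
    rw [he]; ring] at vB
  rw [show (⟨c 0 + p 0, c 1 + p 1⟩ : ℂ) * ⟨a 0 + p 0, a 1 + p 1⟩ * ⟨b 0 + p 0, b 1 + p 1⟩ = e by
    rw [he]; ring] at vC
  -- Moving the origin from the circumcentre to P and separating real and imaginary parts gives the
  -- coefficients m and n.
  have base : ∀ z : Plane, (z 0 + p 0) ^ 2 + (z 1 + p 1) ^ 2 = 1 →
      ((⟨z 0 + p 0, z 1 + p 1⟩ : ℂ) - ⟨p 0, p 1⟩) * ((⟨z 0 + p 0, z 1 + p 1⟩ : ℂ) - ⟨p 0 + h, p 1⟩)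
        + e * (conj (⟨z 0 + p 0, z 1 + p 1⟩ : ℂ) - conj (⟨p 0, p 1⟩ : ℂ)) *
          (conj (⟨p 0 + h, p 1⟩ : ℂ) * ⟨z 0 + p 0, z 1 + p 1⟩ - 1) = 0 →
      IsBasePoint p h (e.re * (p 0 + h) + e.im * p 1) (e.im * (p 0 + h) - e.re * p 1)
        (e.re * (h * p 0 - (1 - p 0 ^ 2 - p 1 ^ 2)) - e.im * (h * p 1))
        (e.re * (h * p 1) + e.im * (h * p 0 - (1 - p 0 ^ 2 - p 1 ^ 2))) z := by
    intro z hz hF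
    have hre := congrArg Complex.re hF
    have him := congrArg Complex.im hF
    simp at hre him
    exact ⟨hz, by linear_combination hre, by linear_combination him⟩
  refine ⟨e.re, e.im, _, _, _, _, _, ?_, rfl, rfl, rfl, rfl, rfl, ?_, ?_, base a ha vA,
    base b hb vB, base c hc vC⟩
  · have := congrArg Complex.re ue
    simp at this
    linear_combination this
  · intro hp
    rcases eq_vertex_of_unit (unit hp) h1 h2 with h' | h' | h' <;> have h' := Complex.ext_iff.1 h' <;>
      simp at h'
    · exact ha0 (plane_ext (by simp [h'.1]) (by simp [h'.2]))
    · exact hb0 (plane_ext (by simp [h'.1]) (by simp [h'.2]))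
    · exact hc0 (plane_ext (by simp [h'.1]) (by simp [h'.2]))
  · intro hp
    rcases eq_vertex_of_unit (q := ⟨p 0, p 1⟩) (a := ⟨a 0 + p 0, a 1 + p 1⟩)
      (b := ⟨b 0 + p 0, b 1 + p 1⟩) (c := ⟨c 0 + p 0, c 1 + p 1⟩) (unit hp) (by linear_combination h1)
      (by linear_combination h2) with h' | h' | h' <;> have h' := Complex.ext_iff.1 h' <;>
      simp at h'
    · exact hah (plane_ext (by simp; linarith [h'.1]) (by simp [h'.2]))
    · exact hbh (plane_ext (by simp; linarith [h'.1]) (by simp [h'.2]))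
    · exact hch (plane_ext (by simp; linarith [h'.1]) (by simp [h'.2]))

theorem Conic.exists_pencil_coefficients {p a b c : Plane} {h m₁ m₂ n₁ n₂ : ℝ}
    (ha : IsBasePoint p h m₁ m₂ n₁ n₂ a) (hb : IsBasePoint p h m₁ m₂ n₁ n₂ b)
    (hc : IsBasePoint p h m₁ m₂ n₁ n₂ c) (hp : p 0 ^ 2 + p 1 ^ 2 ≠ 1)
    (hne : cross (c - a) (b - a) ≠ 0) {K : Conic} (hf : K.f = 0)
    (hKa : K.eval a = 0) (hKb : K.eval b = 0) (hKc : K.eval c = 0) :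
    ∃ x y : ℝ, K.a = x * (1 + m₁) - y * m₂ ∧ K.b = - 2 * y ∧ K.c = x * (m₁ - 1) - y * m₂ ∧
      K.d = x * (n₁ - h) - y * n₂ ∧ K.e = x * n₂ + y * (h + n₁) := by
  simp only [Conic.eval, hf, add_zero] at hKa hKb hKc
  refine mem_pencil (fun h0 => hne ?_) hp ha.circle hb.circle hc.circle ha.re hb.re hc.re
    ha.im hb.im hc.im hKa hKb hKc
  simp only [cross, PiLp.sub_apply]
  linear_combination -h0

/-- The coefficients of a circle that is tangent at two points of the first axis, the origin being
one of them, to a conic of the pencil. -/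
theorem bitangent_circle_coefficients {p a b c P v : Plane} {h m₁ m₂ n₁ n₂ : ℝ}
    (ha : IsBasePoint p h m₁ m₂ n₁ n₂ a) (hb : IsBasePoint p h m₁ m₂ n₁ n₂ b)
    (hc : IsBasePoint p h m₁ m₂ n₁ n₂ c) (hp : p 0 ^ 2 + p 1 ^ 2 ≠ 1)
    (hne : cross (c - a) (b - a) ≠ 0) (hv : v 0 ^ 2 + v 1 ^ 2 ≠ 0)
    {K : Conic} {γ : Sphere Plane} {q : ℝ} {g : Plane} (hq : q ≠ 0)
    (hg : γ.center = frame P v g)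
    (hKa : frame P v a ∈ K) (hKb : frame P v b ∈ K) (hKc : frame P v c ∈ K)
    (h1 : K.IsTangentToCircleAt γ P) (h2 : K.IsTangentToCircleAt γ (frame P v !₂[q, 0])) :
    1 + m₁ ≠ 0 ∧ (1 + m₁) * q = h - n₁ ∧ 2 * (1 + m₁) * g 0 = h - n₁ ∧
      2 * (1 + m₁) * g 1 = -n₂ := by
  have hP : P = frame P v 0 := plane_ext (by simp) (by simp)
  obtain ⟨k1, g1, ⟨s, hs⟩, u, hu, ku, gu⟩ := h1.exists_direction
  obtain ⟨k2, g2, -, w, hw, kw, gw⟩ := h2.exists_direction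
  obtain ⟨u, rfl⟩ : ∃ u', u = turn v u' := ⟨_, (turn_coords hv u).symm⟩
  obtain ⟨w, rfl⟩ : ∃ w', w = turn v w' := ⟨_, (turn_coords hv w).symm⟩
  obtain ⟨s, rfl⟩ : ∃ s', s = turn v s' := ⟨_, (turn_coords hv s).symm⟩
  have hf : (K.pull P v hv).f = 0 := k1
  rw [hP, Conic.dirDeriv_frame _ _ _ hv] at hs ku
  rw [Conic.eval_frame _ _ _ hv] at k2
  rw [Conic.dirDeriv_frame _ _ _ hv] at kw
  rw [Conic.mem_iff, Conic.eval_frame _ _ _ hv] at hKa hKb hKc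
  obtain ⟨x, y, ea, eb, -, ed, ee⟩ :=
    Conic.exists_pencil_coefficients ha hb hc hp hne hf hKa hKb hKc
  have s1 := sq_add_sq_eq_of_mem_sphere g1
  have s2 := sq_add_sq_eq_of_mem_sphere g2
  rw [← s1, hg] at s2
  rw [hg] at gu gw
  generalize K.pull P v hv = L at *
  simp [Conic.eval, Conic.dirDeriv, hf] at hs ku k2 kw
  simp at s2 gu gw
  obtain ⟨hb0, ha0, h3, h4, h5⟩ := bitangent_coefficients (a := L.a) (b := L.b) (d := L.d)
    (e := L.e) (q := q) (g₁ := g 0) (g₂ := g 1) (u₁ := u 0) (u₂ := u 1) (w₁ := w 0) (w₂ := w 1) hq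
    (by linear_combination k2)
    (by apply mul_left_cancel₀ hv; linear_combination s2)
    (turn_ne_zero hu) (turn_ne_zero hw)
    (by by_contra! h0; apply hs; rw [h0.1, h0.2]; ring)
    (by linear_combination ku)
    (by apply mul_left_cancel₀ hv; linear_combination -gu)
    (by linear_combination kw)
    (by apply mul_left_cancel₀ hv; linear_combination gw)
  -- Without an xy term, only the multiples of Re F remain in the pencil.
  have hy : y = 0 := by linarith
  subst hy
  have hx : x ≠ 0 := by
    rintro rfl
    apply ha0
    linarith
  have h6 : 1 + m₁ ≠ 0 := by
    intro h0
    apply ha0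
    rw [ea, h0]; ring
  have h7 : (1 + m₁) * q = h - n₁ := by
    apply mul_left_cancel₀ hx
    linear_combination h3 - q * ea + -ed
  refine ⟨h6, h7, by linear_combination h7 + (1 + m₁) * h4, ?_⟩
  apply mul_left_cancel₀ hx
  linear_combination h5 - 2 * g 1 * ea - ee

/-- If P' were a vertex, isogonality at the next vertex would put P on a side line. At the vertex P'
itself the condition is vacuous, since a vector there is zero. -/
theorem ne_of_isIsogonalConjugate {A B C P P' : Plane} (hAB : A ≠ B) (hBC : B ≠ C) (hCA : C ≠ A)
    (h : IsIsogonalConjugate A B C P P') : A ≠ P' ∧ B ≠ P' ∧ C ≠ P' := by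
  have key : ∀ {X Y Z : Plane}, X ≠ Y → Y ≠ Z → P ∉ line[ℝ, Y, Z] →
      IsogonalAt Y Z X P P' → X ≠ P' := by
    rintro X Y Z hXY hYZ hP hI rfl
    refine hP (mem_line_of_cross_eq_zero hYZ ?_)
    have hN : (X 0 - Y 0) ^ 2 + (X 1 - Y 1) ^ 2 ≠ 0 := fun h0 => hXY (plane_ext
      (by nlinarith [sq_nonneg (X 1 - Y 1)]) (by nlinarith [sq_nonneg (X 0 - Y 0)]))
    apply mul_left_cancel₀ hN
    simp only [IsogonalAt, SameDirectedAngle, cross, inner_plane, PiLp.sub_apply] at hI ⊢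
    linear_combination -hI
  exact ⟨key hAB hBC h.notMem_BC h.atB, key hBC hCA h.notMem_CA h.atC,
    key hCA hAB h.notMem_AB h.atA⟩

theorem sameDirectedAngle_of_frame {P v x y z w t : Plane} (hv : v 0 ^ 2 + v 1 ^ 2 ≠ 0)
    (h : SameDirectedAngle (frame P v y - frame P v x) (frame P v z - frame P v x)
      (frame P v w - frame P v x) (frame P v t - frame P v x)) :
    SameDirectedAngle (y - x) (z - x) (w - x) (t - x) := by
  simp only [SameDirectedAngle, cross, inner_plane, PiLp.sub_apply, frame_zero, frame_one] at h ⊢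
  apply mul_left_cancel₀ (pow_ne_zero 2 hv)
  linear_combination h

/-- A conic of the pencil that passes through `(h, 0)` and does not contain the first axis: the
equation of its tangent at `(h, 0)`. -/
theorem tangent_of_nondegenerate {p : Plane} {h e₁ e₂ m₁ m₂ n₁ n₂ t a b d e x y : ℝ} (hh : h ≠ 0)
    (he : e₁ ^ 2 + e₂ ^ 2 = 1)
    (hm₁ : m₁ = e₁ * (p 0 + h) + e₂ * p 1) (hm₂ : m₂ = e₂ * (p 0 + h) - e₁ * p 1)
    (ht : t = h * p 0 - (1 - p 0 ^ 2 - p 1 ^ 2)) (hn₁ : n₁ = e₁ * t - e₂ * (h * p 1))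
    (hn₂ : n₂ = e₁ * (h * p 1) + e₂ * t) (hp' : (p 0 + h) ^ 2 + p 1 ^ 2 ≠ 1)
    (ha : a = x * (1 + m₁) - y * m₂) (hb : b = - 2 * y)
    (hd : d = x * (n₁ - h) - y * n₂) (hE : e = x * n₂ + y * (h + n₁))
    (ha0 : a ≠ 0) (hP' : a * h ^ 2 + d * h = 0) :
    p 1 + e₂ ≠ 0 ∧ ∀ η₁ η₂ : ℝ, (2 * a * h + d) * η₁ + (b * h + e) * η₂ = 0 →
      h * (p 1 + e₂) * η₁ + (t - e₁ * h) * η₂ = 0 := by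
  have h1 : a * h + d = 0 := by apply mul_left_cancel₀ hh; linear_combination hP'
  -- Here F(P') = h e (|p + h|² − 1), so passing through P' fixes the ratio x : y = e₂ : e₁.
  have h2 : x * e₁ = y * e₂ := by
    have h3 : (p 0 + h) ^ 2 + p 1 ^ 2 - 1 ≠ 0 := sub_ne_zero.2 hp'
    apply mul_left_cancel₀ h3
    subst hd ha hn₁ hn₂ hm₁ hm₂ ht
    linear_combination h1
  obtain ⟨κ, hκ⟩ : ∃ κ, κ = x * e₂ + y * e₁ := ⟨_, rfl⟩
  have hx : x = κ * e₂ := by rw [hκ]; linear_combination -x * he + e₁ * h2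
  have hy : y = κ * e₁ := by rw [hκ]; linear_combination -y * he - e₂ * h2
  have hA : a = κ * (p 1 + e₂) := by
    rw [ha, hx, hy, hm₁, hm₂]; linear_combination κ * p 1 * he
  have hκ0 : κ ≠ 0 := by rintro rfl; apply ha0; rw [hA]; ring
  have hw : p 1 + e₂ ≠ 0 := by intro h0; apply ha0; rw [hA, h0]; ring
  have hB : b * h + e = κ * (t - e₁ * h) := by
    rw [hb, hE, hx, hy, hn₁, hn₂]; linear_combination κ * t * he
  refine ⟨hw, fun η₁ η₂ hη => ?_⟩
  apply mul_left_cancel₀ hκ0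
  linear_combination hη - h * η₁ * hA - η₂ * hB - η₁ * h1

/-! ### The theorem -/

theorem theorem4p5
    -- the triangle and its circumcircle
    (A B C : Plane) (hABC : AffineIndependent ℝ ![A, B, C])
    (Ω : Sphere Plane) (hAΩ : A ∈ Ω) (hBΩ : B ∈ Ω) (hCΩ : C ∈ Ω)
    -- a circumconic tangent to a circle at two points
    (𝒞 : Conic) (hA : A ∈ 𝒞) (hB : B ∈ 𝒞) (hC : C ∈ 𝒞)
    (γ : Sphere Plane) (P Q : Plane) (hPQ : P ≠ Q)
    (hP : 𝒞.IsTangentToCircleAt γ P) (hQ : 𝒞.IsTangentToCircleAt γ Q)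
    -- the isogonal conjugate of `P` lies on `PQ`
    (P' : Plane) (hPP' : P ≠ P') (hiso : IsIsogonalConjugate A B C P P')
    (hP' : P' ∈ line[ℝ, P, Q])
    -- the conic through `A`, `B`, `C`, `P`, `P'`, and a tangent of it
    (ℋ : Conic) (hℋ : ℋ.IsTheConicThrough {A, B, C, P, P'}) (hℋn : ℋ.IsNondegenerate)
    (P₀ : Plane) (hP₀ : P₀ ∈ Ω) (htan : ℋ.IsTangentAt P' line[ℝ, P', P₀]) :
    (∃ X : Plane, X ∈ γ ∧ X ∈ Ω ∧
      ∃ 𝒦 : Conic, 𝒦.IsTheConicThrough {A, B, C, P, X} ∧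
        -- the line `P₀X` meets `γ` again, on the conic
        (P₀ ≠ X → ¬ γ.IsTangentAt X line[ℝ, P₀, X] →
          ∃ Z ∈ line[ℝ, P₀, X], Z ≠ X ∧ Z ∈ γ ∧ Z ∈ 𝒦) ∧
        -- limiting case: the second intersection with `γ` is `X` itself, counted twice
        (P₀ ≠ X → γ.IsTangentAt X line[ℝ, P₀, X] → 𝒦.IsTangentAt X line[ℝ, P₀, X]) ∧
        -- limiting case: the line `P₀X` is the tangent to `Ω` at `X`
        (P₀ = X → ∃ Z, Z ≠ X ∧ Ω.IsTangentAt X line[ℝ, X, Z] ∧ Z ∈ γ ∧ Z ∈ 𝒦)) ∧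
    -- exactly one point of the line `PP'` other than `P` gives double tangency
    (∃! R : Plane, R ∈ line[ℝ, P, P'] ∧ R ≠ P ∧
      ∃ (𝒞' : Conic) (γ' : Sphere Plane), A ∈ 𝒞' ∧ B ∈ 𝒞' ∧ C ∈ 𝒞' ∧
        𝒞'.IsTangentToCircleAt γ' P ∧ 𝒞'.IsTangentToCircleAt γ' R) := by
  have hAB : A ≠ B := fun h => by simpa using hABC.injective.ne (show (0 : Fin 3) ≠ 1 by decide) h
  have hBC : B ≠ C := fun h => by simpa using hABC.injective.ne (show (1 : Fin 3) ≠ 2 by decide) h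
  have hCA : C ≠ A := fun h => by simpa using hABC.injective.ne (show (2 : Fin 3) ≠ 0 by decide) h
  have hABC' := cross_ne_zero_of_affineIndependent hABC
  obtain ⟨hAP', hBP', hCP'⟩ := ne_of_isIsogonalConjugate hAB hBC hCA hiso
  have hAP : A ≠ P := fun h => hiso.notMem_AB (h ▸ left_mem_affineSpan_pair ℝ A B)
  have hBP : B ≠ P := fun h => hiso.notMem_BC (h ▸ left_mem_affineSpan_pair ℝ B C)
  have hCP : C ≠ P := fun h => hiso.notMem_CA (h ▸ left_mem_affineSpan_pair ℝ C A)
  have hR : Ω.radius ≠ 0 := by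
    intro h0
    apply hAB
    rw [EuclideanGeometry.mem_sphere, h0, dist_eq_zero] at hAΩ hBΩ
    rw [hAΩ, hBΩ]
  have hR0 : 0 ≤ Ω.radius := by rw [← EuclideanGeometry.mem_sphere.1 hAΩ]; exact dist_nonneg
  obtain ⟨v, h, hvR, hh, hP'v⟩ := exists_frame hPP' hR
  have hv : v 0 ^ 2 + v 1 ^ 2 ≠ 0 := by rw [hvR]; exact pow_ne_zero 2 hR
  have hP0 : P = frame P v 0 := plane_ext (by simp) (by simp)
  obtain ⟨a, rfl⟩ : ∃ a, A = frame P v a := ⟨_, (frame_coords hv P A).symm⟩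
  obtain ⟨b, rfl⟩ : ∃ b, B = frame P v b := ⟨_, (frame_coords hv P B).symm⟩
  obtain ⟨c, rfl⟩ : ∃ c, C = frame P v c := ⟨_, (frame_coords hv P C).symm⟩
  obtain ⟨p₀, rfl⟩ : ∃ p₀, P₀ = frame P v p₀ := ⟨_, (frame_coords hv P P₀).symm⟩
  obtain ⟨p, hp⟩ : ∃ p, Ω.center = frame P v (-p) :=
    ⟨-coords P v Ω.center, by rw [neg_neg, frame_coords hv]⟩
  obtain ⟨g, hg⟩ : ∃ g, γ.center = frame P v g := ⟨_, (frame_coords hv P γ.center).symm⟩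
  have circ : ∀ {z : Plane}, frame P v z ∈ Ω → (z 0 + p 0) ^ 2 + (z 1 + p 1) ^ 2 = 1 := by
    intro z hz
    have h1 := sq_add_sq_eq_of_mem_sphere hz
    rw [← hvR, hp] at h1
    simp at h1
    apply mul_left_cancel₀ hv
    linear_combination h1
  have hne : cross (c - a) (b - a) ≠ 0 := by
    intro h0
    apply hABC'
    simp only [cross, PiLp.sub_apply, frame_zero, frame_one] at h0 ⊢
    linear_combination (v 0 ^ 2 + v 1 ^ 2) * h0
  have fne : ∀ {x y : Plane}, frame P v x ≠ frame P v y → x ≠ y :=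
    fun hxy hx => hxy (congrArg (frame P v) hx)
  have hiA := hiso.atA
  have hiB := hiso.atB
  rw [hP'v] at hAP' hBP' hCP' hiA hiB
  unfold IsogonalAt at hiA hiB
  obtain ⟨e₁, e₂, m₁, m₂, n₁, n₂, t, he, hm₁, hm₂, ht, hn₁, hn₂, hp1, hp'1, ba, bb, bc⟩ :=
    exists_pencil (circ hAΩ) (circ hBΩ) (circ hCΩ) (fne hAB) (fne hBC) (fne hCA)
      (fun h0 => hAP (by rw [h0]; exact hP0.symm)) (fun h0 => hBP (by rw [h0]; exact hP0.symm))
      (fun h0 => hCP (by rw [h0]; exact hP0.symm))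
      (fne hAP') (fne hBP') (fne hCP')
      (sameDirectedAngle_of_frame hv (P := P) (by rw [← hP0]; exact hiA))
      (sameDirectedAngle_of_frame hv (P := P) (by rw [← hP0]; exact hiB))
  -- The answer depends on the pencil alone; it serves for γ and Q, and for any competing point R.
  have bit : ∀ {𝒞' : Conic} {γ' : Sphere Plane} {R : Plane}, R ∈ line[ℝ, P, P'] → R ≠ P →
      frame P v a ∈ 𝒞' → frame P v b ∈ 𝒞' → frame P v c ∈ 𝒞' →
      𝒞'.IsTangentToCircleAt γ' P → 𝒞'.IsTangentToCircleAt γ' R →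
      1 + m₁ ≠ 0 ∧ R = frame P v !₂[(h - n₁) / (1 + m₁), 0] ∧
      ∀ g', γ'.center = frame P v g' →
        2 * (1 + m₁) * g' 0 = h - n₁ ∧ 2 * (1 + m₁) * g' 1 = -n₂ := by
    intro 𝒞' γ' R hRl hRP h1 h2 h3 h4 h5
    obtain ⟨r, hr⟩ := mem_line_iff.1 hRl
    have hRf : R = frame P v !₂[r * h, 0] := by
      rw [hr, hP'v]
      apply plane_ext <;> simp <;> ring
    have hr0 : r * h ≠ 0 := by
      intro h0
      apply hRP
      rw [hRf, h0]
      apply plane_ext <;> simp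
    rw [hRf] at h5
    have key := fun g' hg' => bitangent_circle_coefficients ba bb bc hp1 hne hv (g := g') hr0 hg'
      h1 h2 h3 h4 h5
    obtain ⟨k1, k2, -, -⟩ := key _ (frame_coords hv P γ'.center).symm
    refine ⟨k1, ?_, fun g' hg' => (key g' hg').2.2⟩
    rw [hRf, ← k2, mul_div_cancel_left₀ _ k1]
  have hQl : Q ∈ line[ℝ, P, P'] := by
    obtain ⟨r, hr⟩ := mem_line_iff.1 hP'
    have hr0 : r ≠ 0 := by
      rintro rfl
      exact hPP' (by rw [hr]; simp)
    refine mem_line_iff.2 ⟨r⁻¹, ?_⟩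
    rw [hr, add_sub_cancel_left, smul_smul, inv_mul_cancel₀ hr0]
    module
  obtain ⟨hμ, hQf, hgγ⟩ := bit hQl hPQ.symm hA hB hC hP hQ
  obtain ⟨hg0, hg1⟩ := hgγ g hg
  refine ⟨?_, Q, ⟨hQl, hPQ.symm, 𝒞, γ, hA, hB, hC, hP, hQ⟩, ?_⟩
  swap
  · rintro R ⟨hRl, hRP, 𝒞', γ', h1, h2, h3, h4, h5⟩
    rw [(bit hRl hRP h1 h2 h3 h4 h5).2.1, hQf]
  have hℋm := hℋ.1
  simp only [Set.mem_insert_iff, Set.mem_singleton_iff, forall_eq_or_imp, forall_eq,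
    Conic.mem_iff] at hℋm
  obtain ⟨hHa, hHb, hHc, hHP, hHP'⟩ := hℋm
  have hHt := htan.2.2.2 _ (right_mem_affineSpan_pair ℝ P' _)
  have hfr : frame P v p₀ - P' = turn v (p₀ - !₂[h, 0]) := by
    rw [hP'v]; apply plane_ext <;> simp <;> ring
  rw [hfr, hP'v, Conic.dirDeriv_frame _ _ _ hv] at hHt
  have hv0 : v ≠ 0 := fun h0 => hv (by simp [h0])
  rw [hP'v] at hHP'
  rw [Conic.eval_frame _ _ _ hv] at hHa hHb hHc hHP'
  have hHa0 : (ℋ.pull P v hv).a ≠ 0 ∨ (ℋ.pull P v hv).d ≠ 0 := by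
    by_contra! h0
    exact Conic.not_line_of_isNondegenerate hℋn hv0 hHP h0.2 h0.1
  have hHf : (ℋ.pull P v hv).f = 0 := hHP
  obtain ⟨x, y, ea, eb, -, ed, ee⟩ :=
    Conic.exists_pencil_coefficients ba bb bc hp1 hne hHf hHa hHb hHc
  generalize ℋ.pull P v hv = H at *
  simp [Conic.eval, Conic.dirDeriv, hHf] at hHP' hHt
  have hHa0' : H.a ≠ 0 := by
    intro h0
    rcases hHa0 with h1 | h1
    · exact h1 h0
    · rw [h0] at hHP'
      exact mul_ne_zero h1 hh (by linarith)
  obtain ⟨hw2, hline⟩ := tangent_of_nondegenerate hh he hm₁ hm₂ ht hn₁ hn₂ hp'1 ea eb ed ee hHa0'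
    hHP'
  have hℓ := hline _ _ hHt
  obtain ⟨w₁, hw₁⟩ : ∃ w₁, w₁ = p 0 + e₁ := ⟨_, rfl⟩
  obtain ⟨w₂, hw₂⟩ : ∃ w₂, w₂ = p 1 + e₂ := ⟨_, rfl⟩
  obtain ⟨k, hk⟩ : ∃ k, k = 1 - p 0 ^ 2 - p 1 ^ 2 := ⟨_, rfl⟩
  obtain ⟨W, hW⟩ : ∃ W, W = w₁ ^ 2 + w₂ ^ 2 := ⟨_, rfl⟩
  rw [← hw₂] at hw2 hℓ
  have hW0 : W ≠ 0 := by
    have : 0 < w₂ ^ 2 := by positivity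
    rw [hW]; nlinarith [sq_nonneg w₁]
  have hk0 : k ≠ 0 := fun h0 => hp1 (by linarith)
  -- k is minus the power of P with respect to Ω and −w lies on Ω, so lw with l = k/|w|² is the
  -- other point of Ω on that line.
  obtain ⟨l, hl⟩ : ∃ l, k = l * W := ⟨k / W, (div_mul_cancel₀ _ hW0).symm⟩
  have htk : t = h * p 0 - k := by rw [ht, hk]
  have hl0 : l ≠ 0 := by rintro rfl; exact hk0 (by rw [hl]; ring)
  have id₁ := fun X Y => second_intersection_identity (x := X) (y := Y) he.symm hw₁ hw₂ hk hW hm₁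
    hm₂ htk hn₁ hn₂
  have id₂ := tangent_derivative_identity he.symm hw₁ hw₂ hk hW hm₁ hm₂ htk hn₁ hn₂
  obtain ⟨id₃, id₄⟩ := pencil_value_identities he.symm hw₁ hw₂ hk hW hm₁ hm₂ htk hn₁ hn₂
  rw [hl] at id₂ id₃ id₄
  simp only [hl] at id₁
  -- the values at `ξ = l w` of the spanning functions
  have vre : (l * w₁) ^ 2 - (l * w₂) ^ 2 - h * (l * w₁) + m₁ * ((l * w₁) ^ 2 + (l * w₂) ^ 2)
      + n₁ * (l * w₁) + n₂ * (l * w₂) = -(2 * l ^ 2 * w₂ ^ 2) := by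
    apply mul_left_cancel₀ (pow_ne_zero 2 hW0)
    linear_combination id₃
  have vim : 2 * (l * w₁) * (l * w₂) - h * (l * w₂) + m₂ * ((l * w₁) ^ 2 + (l * w₂) ^ 2)
      + n₂ * (l * w₁) - n₁ * (l * w₂) = 2 * l ^ 2 * w₁ * w₂ := by
    apply mul_left_cancel₀ (pow_ne_zero 2 hW0)
    linear_combination id₄
  have hξΩ : (l * w₁ + p 0) ^ 2 + (l * w₂ + p 1) ^ 2 = 1 := by
    have h1 : k = W - 2 * (w₁ * p 0 + w₂ * p 1) := by
      rw [hk, hW, hw₁, hw₂]; linear_combination -he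
    linear_combination l * h1 - l * hl - l ^ 2 * hW + hk - hl
  -- L is Re(w̄F); its xy coefficient 2w₂ is nonzero because ℋ does not contain the line PP'.
  obtain ⟨L, hLa, hLb, hLc, hLd, hLe, hLf⟩ : ∃ L : Conic, L.a = w₁ * (1 + m₁) + w₂ * m₂ ∧
      L.b = 2 * w₂ ∧ L.c = w₁ * (m₁ - 1) + w₂ * m₂ ∧ L.d = w₁ * (n₁ - h) + w₂ * n₂ ∧
      L.e = w₁ * n₂ - w₂ * (h + n₁) ∧ L.f = 0 :=
    ⟨⟨_, _, _, _, _, _, Or.inr (Or.inl (mul_ne_zero two_ne_zero hw2))⟩, rfl, rfl, rfl, rfl, rfl,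
      rfl⟩
  obtain ⟨𝒦, hKe, hKd, hKq⟩ := Conic.exists_push L P v hv
  have hLbase : ∀ {z : Plane}, IsBasePoint p h m₁ m₂ n₁ n₂ z → frame P v z ∈ 𝒦 := by
    intro z hz
    rw [Conic.mem_iff, hKe]
    simp only [Conic.eval, hLa, hLb, hLc, hLd, hLe, hLf]
    linear_combination w₁ * hz.re + w₂ * hz.im
  have hKP : P ∈ 𝒦 := by
    rw [hP0, Conic.mem_iff, hKe]
    simp [Conic.eval, hLf]
  have hKX : frame P v !₂[l * w₁, l * w₂] ∈ 𝒦 := by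
    rw [Conic.mem_iff, hKe]
    simp [Conic.eval, hLa, hLb, hLc, hLd, hLe, hLf]
    linear_combination w₁ * vre + w₂ * vim
  have hPγ := hP.exists_direction.2.1
  have hXγ : frame P v !₂[l * w₁, l * w₂] ∈ γ := by
    refine mem_sphere_of_sq_add_sq ?_ ?_
    · rw [← EuclideanGeometry.mem_sphere.1 hPγ]; exact dist_nonneg
    · rw [← sq_add_sq_eq_of_mem_sphere hPγ, hg]
      simp
      apply mul_left_cancel₀ hμ
      linear_combination (v 0 ^ 2 + v 1 ^ 2) * (vre - l * w₁ * hg0 - l * w₂ * hg1)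
  have hXΩ : frame P v !₂[l * w₁, l * w₂] ∈ Ω := by
    refine mem_sphere_of_sq_add_sq hR0 ?_
    rw [← hvR, hp]
    simp
    linear_combination (v 0 ^ 2 + v 1 ^ 2) * hξΩ
  refine ⟨_, hXγ, hXΩ, 𝒦, ⟨?_, ?_⟩, second_intersection_cases hR hXΩ hXγ hKX hP₀ ?_ ?_⟩
  · simp only [Set.mem_insert_iff, Set.mem_singleton_iff, forall_eq_or_imp, forall_eq]
    exact ⟨hLbase ba, hLbase bb, hLbase bc, hKP, hKX⟩
  · intro K' hK'
    simp only [Set.mem_insert_iff, Set.mem_singleton_iff, forall_eq_or_imp, forall_eq,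
      Conic.mem_iff] at hK'
    obtain ⟨h1, h2, h3, h4, h5⟩ := hK'
    rw [Conic.eval_frame _ _ _ hv] at h1 h2 h3 h5
    have hf : (K'.pull P v hv).f = 0 := h4
    obtain ⟨x', y', fa, fb, fc, fd, fe⟩ :=
      Conic.exists_pencil_coefficients ba bb bc hp1 hne hf h1 h2 h3
    simp [Conic.eval, hf, fa, fb, fc, fd, fe] at h5
    -- Re((x' + iy')F) takes the value −2l²w₂(x'w₂ + y'w₁) at X, which determines x' : y'.
    have hxy : x' * w₂ = -y' * w₁ := by
      apply mul_left_cancel₀ (mul_ne_zero (mul_ne_zero two_ne_zero (pow_ne_zero 2 hl0)) hw2)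
      linear_combination x' * vre - y' * vim - h5
    obtain ⟨r, hr⟩ : ∃ r, y' = -r * w₂ := ⟨-y' / w₂, by field_simp⟩
    have hx' : x' = r * w₁ := by
      apply mul_right_cancel₀ hw2
      rw [hxy, hr]; ring
    refine ⟨r, fun Z => ?_⟩
    rw [← frame_coords hv P Z, hKe, Conic.eval_frame _ _ _ hv]
    simp only [Conic.eval, hLa, hLb, hLc, hLd, hLe, hLf, fa, fb, fc, fd, fe, hf, hr, hx']
    ring
  · intro T hT
    obtain ⟨τ, rfl⟩ : ∃ τ, T = turn v τ := ⟨_, (turn_coords hv T).symm⟩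
    rw [hKq, hKd, hg]
    have hT0 := hT 0
    have hT1 := hT 1
    rw [hp] at hT0 hT1
    simp at hT0 hT1
    have q0 : (τ 0 ^ 2 + τ 1 ^ 2) * (p₀ 0 - l * w₁) =
        -2 * ((l * w₁ + p 0) * τ 0 + (l * w₂ + p 1) * τ 1) * τ 0 := by
      apply mul_left_cancel₀ (pow_ne_zero 2 hv)
      linear_combination v 0 * hT0 + v 1 * hT1
    have q1 : (τ 0 ^ 2 + τ 1 ^ 2) * (p₀ 1 - l * w₂) =
        -2 * ((l * w₁ + p 0) * τ 0 + (l * w₂ + p 1) * τ 1) * τ 1 := by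
      apply mul_left_cancel₀ (pow_ne_zero 2 hv)
      linear_combination v 0 * hT1 - v 1 * hT0
    have key := id₁ (τ 0) (τ 1)
    -- By `q0` and `q1` the second intersection with Ω is P₀, which lies on the tangent of ℋ by
    -- `hℓ`.
    have hY : h * w₂ * ((τ 0 ^ 2 + τ 1 ^ 2) * (l * W * w₁ - W * h)
          - 2 * ((l * W * w₁ + W * p 0) * τ 0 + (l * W * w₂ + W * p 1) * τ 1) * τ 0)
        + (t - e₁ * h) * ((τ 0 ^ 2 + τ 1 ^ 2) * (l * W * w₂)
          - 2 * ((l * W * w₁ + W * p 0) * τ 0 + (l * W * w₂ + W * p 1) * τ 1) * τ 1) = 0 := by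
      linear_combination W * (τ 0 ^ 2 + τ 1 ^ 2) * hℓ - h * w₂ * W * q0 - (t - e₁ * h) * W * q1
    rw [hY, mul_zero] at key
    simp [Conic.quad, Conic.dirDeriv, hLa, hLb, hLc, hLd, hLe]
    apply mul_left_cancel₀ hμ
    apply mul_left_cancel₀ hW0
    linear_combination (v 0 ^ 2 + v 1 ^ 2) * key - (v 0 ^ 2 + v 1 ^ 2) * W *
      ((w₁ * (1 + m₁) + w₂ * m₂) * τ 0 ^ 2 + 2 * w₂ * τ 0 * τ 1 +
        (w₁ * (m₁ - 1) + w₂ * m₂) * τ 1 ^ 2) * (τ 0 * hg0 + τ 1 * hg1)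
  · intro T hT hΩT
    obtain ⟨τ, rfl⟩ : ∃ τ, T = turn v τ := ⟨_, (turn_coords hv T).symm⟩
    have hτ := turn_ne_zero hT
    rw [hKd]
    rw [hp] at hΩT
    simp at hΩT
    have q : (l * w₁ + p 0) * τ 0 + (l * w₂ + p 1) * τ 1 = 0 := by
      apply mul_left_cancel₀ hv
      linear_combination hΩT
    intro h0
    simp [Conic.dirDeriv, hLa, hLb, hLc, hLd, hLe] at h0
    -- τ is σ times the unit radius of Ω at X turned by a right angle.
    obtain ⟨σ, hσ⟩ : ∃ σ, σ = (l * w₁ + p 0) * τ 1 - (l * w₂ + p 1) * τ 0 := ⟨_, rfl⟩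
    have s0 : τ 0 = -σ * (l * w₂ + p 1) := by
      rw [hσ]; linear_combination -τ 0 * hξΩ + (l * w₁ + p 0) * q
    have s1 : τ 1 = σ * (l * w₁ + p 0) := by
      rw [hσ]; linear_combination -τ 1 * hξΩ + (l * w₂ + p 1) * q
    rw [s0, s1] at h0
    have hσ0 : σ ≠ 0 := by
      rintro rfl
      rcases hτ with h1 | h1
      · exact h1 (by rw [s0]; ring)
      · exact h1 (by rw [s1]; ring)
    have h3 : σ * ((l * W) ^ 2 * w₂ * W) = 0 := by
      linear_combination σ * id₂ - W ^ 2 * h0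
    have : σ * ((l * W) ^ 2 * w₂ * W) ≠ 0 := by positivity
    exact this h3
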